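/- Let $\mu$ and $\gamma$ be the morphisms of the free monoid $\{0,1\}^*$ given by $\mu(0)=01,\ \mu(1)=10$ (the Thue–Morse morphism) and $\gamma(0)=001,\ \gamma(1)=1$. They act on infinite words by $\sigma(x_0x_1x_2\cdots)=\sigma(x_0)\sigma(x_1)\sigma(x_2)\cdots$. For an infinite word $\mathbf w$, let $p_{\mathbf w}(m)$ be the number of distinct factors (blocks of consecutive letters) of length $m$ of $\mathbf w$. Let $(k_n)_{n\in\mathbb N}$ be any sequence of non-negative integers, and let $\Sigma_n=\gamma^{k_0}\mu\gamma^{k_1}\mu\cdots\gamma^{k_n}\mu$ (composition of morphisms). Then the limit $$\mathbf w=\lim_{n\to\infty}\Sigma_n(0^\omega),\qquad 0^\omega=000\cdots,$$ exists in $\{0,1\}^{\mathbb N}$ with the product topology of the discrete topology, and: 1. $\mathbf w$ is uniformly recurrent, i.e. every factor of $\mathbf w$ occurs in $\mathbf w$ infinitely often and with bounded gaps; 2. $\mathbf w$ has at most linear complexity, i.e. $p_{\mathbf w}(m)=O(m)$ as $m\to\infty$, if and only if the sequence $(k_n)$ is bounded; 3. for every $n\ge 0$ we have $|\Sigma_n(0)|=|\Sigma_n(1)|$,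 and, denoting this common length by $\ell_n$, $$p_{\mathbf w}(\ell_n)\le 4\ell_n-2 .$$ -/

import Mathlib

open Filter Topology

/-- Finite words over the alphabet `A`: the free monoid `A*`. -/
abbrev Word (A : Type*) := FreeMonoid A

/-- Infinite words (one-sided sequences) over `A`. The topology on this type is the product
topology; the alphabet `Fin 2` used below carries the discrete topology. -/
abbrev InfWord (A : Type*) := ℕ → A

namespace InfWord

variable {A : Type*}

/-- The finite word `u` occurs in `w` at position `j`. -/
def OccursAt (w : InfWord A) (u : Word A) (j : ℕ) : Prop :=
  ∀ (i : ℕ) (hi : i < u.toList.length), w (j + i) = u.toList[i]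

/-- The set of factors of `w` of length `n`. -/
def factors (w : InfWord A) (n : ℕ) : Set (Word A) :=
  {u | u.length = n ∧ ∃ j, w.OccursAt u j}

/-- The complexity function: the number of factors of `w` of length `n`
(this set is finite when the alphabet is finite). -/
noncomputable def complexity (w : InfWord A) (n : ℕ) : ℕ :=
  (w.factors n).ncard

/-- `w` is uniformly recurrent: each factor `u` of `w` occurs infinitely often and with bounded
gaps, i.e. there is `R` such that some occurrence of `u` starts in every
interval `[i, i + R]` of positions. -/
def UniformlyRecurrent (w : InfWord A) : Prop :=
  ∀ u : Word A, (∃ j, w.OccursAt u j) →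
    ∃ R : ℕ, ∀ i : ℕ, ∃ j : ℕ, i ≤ j ∧ j ≤ i + R ∧ w.OccursAt u j

/-- `w` has at most linear complexity. -/
def AtMostLinearComplexity (w : InfWord A) : Prop :=
  (fun n : ℕ => (w.complexity n : ℝ)) =O[atTop] (fun n : ℕ => (n : ℝ))

/-- The prefix of length `n` of `w`. -/
def pre (w : InfWord A) (n : ℕ) : Word A :=
  FreeMonoid.ofList ((List.range n).map w)

/-- The image `σ(w) = σ(w 0) σ(w 1) σ(w 2) ⋯` of an infinite word under a non-erasing morphism
`σ`. For such `σ` the word `σ(w 0) ⋯ σ(w i)` has length at least `i + 1`, so its letter at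
position `i` exists and is the letter of `σ(w)` at position `i`. (The value `default` is never
used for a non-erasing `σ`.) -/
def image [Inhabited A] (σ : Monoid.End (Word A)) (w : InfWord A) : InfWord A :=
  fun i => (σ (w.pre (i + 1))).toList.getD i default

end InfWord

/-- The Thue–Morse morphism `0 ↦ 01`, `1 ↦ 10`. -/
def thueMorse : Monoid.End (Word (Fin 2)) :=
  FreeMonoid.lift ![FreeMonoid.ofList [0, 1], FreeMonoid.ofList [1, 0]]

/-- The morphism `γ` given by `0 ↦ 001`, `1 ↦ 1`. -/
def gammaMorph : Monoid.End (Word (Fin 2)) :=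
  FreeMonoid.lift ![FreeMonoid.ofList [0, 0, 1], FreeMonoid.ofList [1]]

/-- The composition `γ^{k 0} ∘ μ ∘ γ^{k 1} ∘ μ ∘ ⋯ ∘ γ^{k n} ∘ μ` (multiplication in `Monoid.End`
is composition, the leftmost factor being applied last). -/
def prefixComp (k : ℕ → ℕ) (n : ℕ) : Monoid.End (Word (Fin 2)) :=
  ((List.range (n + 1)).map fun i => gammaMorph ^ k i * thueMorse).prod

/-! Since `γ^k(1) = 1` and `γ^(k+1)(0) = γ^k(0) γ^k(0) 1`, the word `γ^k(0)` has length `2^(k+1) -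
1`, so `γ^k μ` is uniform of length `2^(k+1)`; it also fixes first letters. Hence the words `Σ_n(0)`
are nested prefixes of a limit `w`, which is a concatenation of level-`n` blocks. Every
level-`(n+1)` block contains the level-`n` image of 0, which gives uniform recurrence. A factor of
block length `L` lies in two consecutive blocks, which gives `4(L-1) + 2` and, for bounded `k`,
linear complexity by monotonicity. For unbounded `k`, the level-`n` images of `γ^i(0)`, `i < k n`,
are right special. Their suffixes of suitable length are distinct, because `γ^i(0)` ends in `0 1^i`.
This yields `j` right special factors at each of many consecutive lengths, hence superlinear growth.
-/

namespace InfWord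

/-! ### Factors, special factors and complexity. -/

variable {A : Type*}

/-- The word of length `m` occurring in `w` at position `j`. -/
def block (w : InfWord A) (j m : ℕ) : Word A :=
  FreeMonoid.ofList ((List.range m).map fun i => w (j + i))

theorem length_block (w : InfWord A) (j m : ℕ) : (w.block j m).length = m := by
  simp [block, FreeMonoid.length]

theorem occursAt_iff_block (w : InfWord A) (u : Word A) (j : ℕ) :
    w.OccursAt u j ↔ w.block j u.length = u := by
  constructor
  · intro h
    apply FreeMonoid.toList.injective
    apply List.ext_getElem
    · simp [block, FreeMonoid.length]
    · intro i h1 h2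
      simpa [block] using h i h2
  · intro h i hi
    have h1 : (w.block j u.length).toList = u.toList := by rw [h]
    have h2 : i < (w.block j u.length).toList.length := by rw [h1]; exact hi
    have h3 : (w.block j u.length).toList[i] = u.toList[i] := by simp only [h1]
    rw [← h3]
    simp [block]

theorem block_add (w : InfWord A) (j m n : ℕ) :
    w.block j (m + n) = w.block j m * w.block (j + m) n := by
  apply FreeMonoid.toList.injective
  simp [block, List.range_add, Function.comp_def, add_assoc]

theorem occursAt_block (w : InfWord A) (j m : ℕ) : w.OccursAt (w.block j m) j := by
  rw [occursAt_iff_block, length_block]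

theorem occursAt_mul (w : InfWord A) (u v : Word A) (j : ℕ) :
    w.OccursAt (u * v) j ↔ w.OccursAt u j ∧ w.OccursAt v (j + u.length) := by
  simp only [occursAt_iff_block, FreeMonoid.length_mul, block_add]
  constructor
  · intro h
    have h' := congrArg FreeMonoid.toList h
    rw [FreeMonoid.toList_mul, FreeMonoid.toList_mul] at h'
    obtain ⟨h1, h2⟩ := List.append_inj h' (length_block w j u.length)
    exact ⟨FreeMonoid.toList.injective h1, FreeMonoid.toList.injective h2⟩
  · rintro ⟨h1, h2⟩
    rw [h1, h2]

theorem factors_eq_range (w : InfWord A) (m : ℕ) :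
    w.factors m = Set.range fun j => w.block j m := by
  ext u
  constructor
  · rintro ⟨rfl, j, h⟩
    exact ⟨j, (w.occursAt_iff_block u j).1 h⟩
  · rintro ⟨j, rfl⟩
    exact ⟨w.length_block j m, j, w.occursAt_block j m⟩

theorem finite_factors [Finite A] (w : InfWord A) (m : ℕ) : (w.factors m).Finite :=
  (List.finite_length_eq A m).subset fun _ h => h.1

theorem complexity_mono [Finite A] (w : InfWord A) : Monotone w.complexity := by
  intro m n hmn
  let f : Word A → Word A := fun u => FreeMonoid.ofList (u.toList.take m)
  suffices h : w.factors m ⊆ f '' w.factors n from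
    (Set.ncard_le_ncard h ((w.finite_factors n).image f)).trans
      (Set.ncard_image_le (w.finite_factors n))
  rw [factors_eq_range, factors_eq_range]
  rintro _ ⟨j, rfl⟩
  refine ⟨w.block j n, ⟨j, rfl⟩, ?_⟩
  apply FreeMonoid.toList.injective
  simp [f, block, ← List.map_take, List.take_range, hmn]

/-- Each right special factor of length `m` contributes to the growth of the complexity. -/
theorem complexity_add_card_le (w : InfWord (Fin 2)) (m : ℕ) (S : Finset (Word (Fin 2)))
    (hS : ∀ u ∈ S, ∀ a : Fin 2, u * FreeMonoid.of a ∈ w.factors (m + 1)) :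
    w.complexity m + S.card ≤ w.complexity (m + 1) := by
  let E : Fin 2 → Set (Word (Fin 2)) := fun a => {u | u * FreeMonoid.of a ∈ w.factors (m + 1)}
  have hE : ∀ a, E a ⊆ w.factors m := by
    rintro a u ⟨h, j, hj⟩
    refine ⟨?_, j, ((w.occursAt_mul _ _ _).1 hj).1⟩
    simpa using h
  have hfin : ∀ a, (E a).Finite := fun a => (w.finite_factors m).subset (hE a)
  have hunion : E 0 ∪ E 1 = w.factors m := by
    apply Set.Subset.antisymm (Set.union_subset (hE 0) (hE 1))
    rw [factors_eq_range]
    rintro _ ⟨j, rfl⟩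
    have h : w.block j m * FreeMonoid.of (w (j + m)) ∈ w.factors (m + 1) := by
      rw [factors_eq_range]
      refine ⟨j, ?_⟩
      simp only [block_add]
      rfl
    generalize w (j + m) = a at h
    fin_cases a
    · exact Or.inl h
    · exact Or.inr h
  have hinj : ∀ a : Fin 2, Function.Injective fun u : Word (Fin 2) => u * FreeMonoid.of a :=
    fun a => mul_left_injective _
  have hdisj : Disjoint ((fun u : Word (Fin 2) => u * FreeMonoid.of 0) '' E 0)
      ((fun u : Word (Fin 2) => u * FreeMonoid.of 1) '' E 1) := by
    rw [Set.disjoint_left]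
    rintro _ ⟨u, -, rfl⟩ ⟨v, -, h⟩
    have h' := congrArg FreeMonoid.toList h
    simp only [FreeMonoid.toList_mul, FreeMonoid.toList_of] at h'
    have := (List.append_inj' h' rfl).2
    simp at this
  have hsub : ((fun u : Word (Fin 2) => u * FreeMonoid.of 0) '' E 0) ∪
      ((fun u : Word (Fin 2) => u * FreeMonoid.of 1) '' E 1) ⊆ w.factors (m + 1) := by
    rintro _ (⟨u, hu, rfl⟩ | ⟨u, hu, rfl⟩) <;> exact hu
  have h1 := Set.ncard_le_ncard hsub (w.finite_factors _)
  -- Inclusion–exclusion: the union `E 0 ∪ E 1` is all factors of length `m`, and the intersection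
  -- is the set of right special ones.
  rw [Set.ncard_union_eq hdisj ((hfin 0).image _) ((hfin 1).image _),
    Set.ncard_image_of_injective _ (hinj 0), Set.ncard_image_of_injective _ (hinj 1),
    ← Set.ncard_union_add_ncard_inter _ _ (hfin 0) (hfin 1), hunion] at h1
  have h2 : (S : Set (Word (Fin 2))).ncard ≤ (E 0 ∩ E 1).ncard :=
    Set.ncard_le_ncard (fun u hu => ⟨hS u hu 0, hS u hu 1⟩) ((hfin 0).inter_of_left _)
  rw [Set.ncard_coe_finset] at h2
  unfold complexity
  omega

theorem mul_card_le_complexity (w : InfWord (Fin 2)) (m c d : ℕ)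
    (h : ∀ i < d, ∃ S : Finset (Word (Fin 2)), S.card = c ∧
      ∀ u ∈ S, ∀ a : Fin 2, u * FreeMonoid.of a ∈ w.factors (m + i + 1)) :
    d * c ≤ w.complexity (m + d) := by
  induction d with
  | zero => simp
  | succ d ih =>
    obtain ⟨S, hS, h'⟩ := h d (Nat.lt_succ_self d)
    have h1 := w.complexity_add_card_le _ S h'
    have h2 := ih fun i hi => h i (by omega)
    rw [← add_assoc, Nat.succ_mul]
    omega

end InfWord

/-! ### Uniform morphisms and concatenations of blocks. -/

/-- A morphism all of whose letter images have length `L`. -/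
def IsUniform {A : Type*} (σ : Monoid.End (Word A)) (L : ℕ) : Prop :=
  ∀ a, (σ (FreeMonoid.of a)).length = L

namespace IsUniform

variable {A : Type*} {σ τ : Monoid.End (Word A)} {L M : ℕ}

theorem length_apply (h : IsUniform σ L) (u : Word A) : (σ u).length = L * u.length := by
  induction u using FreeMonoid.inductionOn' with
  | one => simp
  | of_mul a u ih => rw [map_mul, FreeMonoid.length_mul, ih, h, FreeMonoid.length_mul]; simp; ring

theorem mul (h : IsUniform σ L) (h' : IsUniform τ M) : IsUniform (σ * τ) (L * M) := fun a => by
  change (σ (τ _)).length = _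
  rw [h.length_apply, h' a]

theorem one : IsUniform (1 : Monoid.End (Word A)) 1 := fun a => by
  simp

/-- Uniform morphisms send the letter at position `q` of a word `u` to the block at position
`L * q` of the image of `u`. -/
theorem occursAt_of_occursAt_apply (h : IsUniform σ L) {w : InfWord A} {u : Word A} {j q : ℕ}
    (hu : w.OccursAt (σ u) j) (hq : q < u.length) :
    ∃ a ∈ u.toList, w.OccursAt (σ (FreeMonoid.of a)) (j + L * q) := by
  induction u using FreeMonoid.inductionOn' generalizing j q with
  | one => simp at hq
  | of_mul a u ih =>
    rw [map_mul, w.occursAt_mul, h a] at hu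
    cases q with
    | zero => exact ⟨a, by simp, by simpa using hu.1⟩
    | succ q =>
      obtain ⟨b, hb, hb'⟩ := ih hu.2 (by simpa [add_comm] using hq)
      refine ⟨b, by simp [hb], ?_⟩
      rwa [show j + L * (q + 1) = j + L + L * q by ring]

end IsUniform

namespace InfWord

/-- If `w` is a concatenation of words `σ a` of length `L`, then it has at most `4 L - 2` factors
of length `L`. -/
theorem complexity_le_of_blocks (w : InfWord (Fin 2)) {σ : Monoid.End (Word (Fin 2))} {L : ℕ}
    (hL : 0 < L) (hσ : IsUniform σ L)
    (h : ∀ q, ∃ a, w.OccursAt (σ (FreeMonoid.of a)) (L * q)) :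
    w.complexity L ≤ 4 * (L - 1) + 2 := by
  -- Unaligned factors are given by two letters and an offset in `1, …, L - 1`; aligned ones are
  -- single blocks, so no second letter is counted for them.
  let f : (Fin 2 × Fin 2) × Fin (L - 1) ⊕ Fin 2 → Word (Fin 2) :=
    Sum.elim (fun x => FreeMonoid.ofList
      (((σ (FreeMonoid.of x.1.1) * σ (FreeMonoid.of x.1.2)).toList.drop (x.2 + 1)).take L))
      fun a => σ (FreeMonoid.of a)
  have hsub : w.factors L ⊆ f '' Set.univ := by
    rw [factors_eq_range]
    rintro _ ⟨j, rfl⟩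
    obtain ⟨a, ha⟩ := h (j / L)
    obtain ⟨b, hb⟩ := h (j / L + 1)
    have hj := Nat.div_add_mod j L
    have hlt := Nat.mod_lt j hL
    generalize j / L = q at *
    generalize j % L = r at *
    subst hj
    rcases r with _ | r
    · refine ⟨Sum.inr a, trivial, ?_⟩
      have := (w.occursAt_iff_block _ _).1 ha
      rw [hσ a] at this
      exact this.symm
    · refine ⟨Sum.inl ((a, b), ⟨r, by omega⟩), trivial, ?_⟩
      have hab : w.OccursAt (σ (FreeMonoid.of a) * σ (FreeMonoid.of b)) (L * q) := by
        rw [occursAt_mul, hσ a]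
        exact ⟨ha, hb⟩
      rw [occursAt_iff_block, FreeMonoid.length_mul, hσ a, hσ b] at hab
      simp only [f, Sum.elim_inl, ← hab]
      apply FreeMonoid.toList.injective
      apply List.ext_getElem
      · simp [block]; omega
      · intro i h1 h2
        simp [block]; congr 1; omega
  have := (Set.ncard_le_ncard hsub (Set.toFinite _)).trans (Set.ncard_image_le Set.finite_univ)
  rw [Set.ncard_univ, Nat.card_eq_fintype_card] at this
  simp only [Fintype.card_sum, Fintype.card_prod, Fintype.card_fin] at this
  unfold complexity
  omega

end InfWord

-- The words `γ^k(0)` and the morphisms `γ^k μ`.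

local notation "𝟎" => FreeMonoid.of (0 : Fin 2)
local notation "𝟏" => FreeMonoid.of (1 : Fin 2)

theorem gammaMorph_pow_one (k : ℕ) : (gammaMorph ^ k) 𝟏 = 𝟏 := by
  induction k with
  | zero => rfl
  | succ k ih =>
    rw [pow_succ]
    exact ih

theorem gammaMorph_pow_succ_zero (k : ℕ) :
    (gammaMorph ^ (k + 1)) 𝟎 = (gammaMorph ^ k) 𝟎 * (gammaMorph ^ k) 𝟎 * 𝟏 := by
  rw [pow_succ]
  change (gammaMorph ^ k) (𝟎 * 𝟎 * 𝟏) = _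
  rw [map_mul, map_mul, gammaMorph_pow_one]

theorem exists_gammaMorph_pow_zero_eq_of_mul (k : ℕ) : ∃ v, (gammaMorph ^ k) 𝟎 = 𝟎 * v := by
  induction k with
  | zero => exact ⟨1, rfl⟩
  | succ k ih =>
    obtain ⟨v, hv⟩ := ih
    rw [gammaMorph_pow_succ_zero, hv]
    exact ⟨v * (𝟎 * v) * 𝟏, by simp only [mul_assoc]⟩

/-- The final run of 1s has length exactly `k`; this later separates the special factors for
different exponents. -/
theorem exists_gammaMorph_pow_zero_eq_mul (k : ℕ) :
    ∃ v, (gammaMorph ^ k) 𝟎 = v * (𝟎 * 𝟏 ^ k) := by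
  induction k with
  | zero => exact ⟨1, rfl⟩
  | succ k ih =>
    obtain ⟨v, hv⟩ := ih
    rw [gammaMorph_pow_succ_zero, hv]
    exact ⟨v * (𝟎 * 𝟏 ^ k) * v, by simp only [mul_assoc, pow_succ]⟩

theorem length_gammaMorph_pow_zero (k : ℕ) :
    ((gammaMorph ^ k) 𝟎).length + 1 = 2 ^ (k + 1) := by
  induction k with
  | zero => rfl
  | succ k ih =>
    rw [gammaMorph_pow_succ_zero, FreeMonoid.length_mul, FreeMonoid.length_mul,
      FreeMonoid.length_of, pow_succ 2 (k + 1), ← ih]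
    ring

theorem gammaMorph_pow_mul_thueMorse_zero (k : ℕ) :
    (gammaMorph ^ k * thueMorse) 𝟎 = (gammaMorph ^ k) 𝟎 * 𝟏 := by
  change (gammaMorph ^ k) (𝟎 * 𝟏) = _
  rw [map_mul, gammaMorph_pow_one]

theorem gammaMorph_pow_mul_thueMorse_one (k : ℕ) :
    (gammaMorph ^ k * thueMorse) 𝟏 = 𝟏 * (gammaMorph ^ k) 𝟎 := by
  change (gammaMorph ^ k) (𝟏 * 𝟎) = _
  rw [map_mul, gammaMorph_pow_one]

theorem isUniform_gammaMorph_pow_mul_thueMorse (k : ℕ) :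
    IsUniform (gammaMorph ^ k * thueMorse) (2 ^ (k + 1)) := by
  intro a
  have := length_gammaMorph_pow_zero k
  fin_cases a
  · simp only [Fin.zero_eta, gammaMorph_pow_mul_thueMorse_zero, FreeMonoid.length_mul,
      FreeMonoid.length_of, this]
  · simp only [Fin.mk_one, gammaMorph_pow_mul_thueMorse_one, FreeMonoid.length_mul,
      FreeMonoid.length_of, ← this, add_comm]

/-! ### Partial products and the limit word. -/

/-- The product of the first `n` morphisms `γ^{k i} μ`. -/
def partialComp (k : ℕ → ℕ) (n : ℕ) : Monoid.End (Word (Fin 2)) :=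
  ((List.range n).map fun i => gammaMorph ^ k i * thueMorse).prod

/-- The common length of the letter images under `partialComp k n`. -/
def blockLength (k : ℕ → ℕ) (n : ℕ) : ℕ :=
  ∏ i ∈ Finset.range n, 2 ^ (k i + 1)

theorem prefixComp_eq_partialComp (k : ℕ → ℕ) (n : ℕ) : prefixComp k n = partialComp k (n + 1) :=
  rfl

theorem partialComp_succ (k : ℕ → ℕ) (n : ℕ) :
    partialComp k (n + 1) = partialComp k n * (gammaMorph ^ k n * thueMorse) := by
  simp [partialComp, List.range_succ]

theorem partialComp_succ_apply (k : ℕ → ℕ) (n : ℕ) (u : Word (Fin 2)) :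
    partialComp k (n + 1) u = partialComp k n ((gammaMorph ^ k n * thueMorse) u) := by
  rw [partialComp_succ]
  rfl

theorem blockLength_succ (k : ℕ → ℕ) (n : ℕ) :
    blockLength k (n + 1) = blockLength k n * 2 ^ (k n + 1) :=
  Finset.prod_range_succ _ _

theorem blockLength_pos (k : ℕ → ℕ) (n : ℕ) : 0 < blockLength k n :=
  Finset.prod_pos fun _ _ => by positivity

theorem isUniform_partialComp (k : ℕ → ℕ) (n : ℕ) :
    IsUniform (partialComp k n) (blockLength k n) := by
  induction n with
  | zero => exact IsUniform.one
  | succ n ih =>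
    rw [partialComp_succ, blockLength_succ]
    exact ih.mul (isUniform_gammaMorph_pow_mul_thueMorse _)

theorem lt_blockLength (k : ℕ → ℕ) (n : ℕ) : n < blockLength k n := by
  induction n with
  | zero => exact blockLength_pos k 0
  | succ n ih =>
    rw [blockLength_succ, pow_succ]
    have := Nat.one_le_two_pow (n := k n)
    nlinarith

theorem exists_gammaMorph_pow_mul_thueMorse_eq_of_mul (k : ℕ) (a : Fin 2) :
    ∃ v, (gammaMorph ^ k * thueMorse) (FreeMonoid.of a) = FreeMonoid.of a * v := by
  fin_cases a
  · obtain ⟨v, hv⟩ := exists_gammaMorph_pow_zero_eq_of_mul k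
    exact ⟨v * 𝟏, by
      simp only [Fin.zero_eta, gammaMorph_pow_mul_thueMorse_zero, hv, mul_assoc]⟩
  · exact ⟨_, gammaMorph_pow_mul_thueMorse_one k⟩

theorem zero_mem_gammaMorph_pow_mul_thueMorse (k : ℕ) (a : Fin 2) :
    ∃ u v, (gammaMorph ^ k * thueMorse) (FreeMonoid.of a) = u * 𝟎 * v := by
  obtain ⟨v, hv⟩ := exists_gammaMorph_pow_zero_eq_of_mul k
  fin_cases a
  · exact ⟨1, v * 𝟏, by
      simp only [Fin.zero_eta, gammaMorph_pow_mul_thueMorse_zero, hv, mul_assoc, one_mul]⟩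
  · exact ⟨𝟏, v, by
      simp only [Fin.mk_one, gammaMorph_pow_mul_thueMorse_one, hv, mul_assoc]⟩

theorem exists_partialComp_eq_of_mul (k : ℕ → ℕ) (n : ℕ) (a : Fin 2) :
    ∃ v, partialComp k n (FreeMonoid.of a) = FreeMonoid.of a * v := by
  induction n with
  | zero => exact ⟨1, rfl⟩
  | succ n ih =>
    obtain ⟨u, hu⟩ := ih
    obtain ⟨v, hv⟩ := exists_gammaMorph_pow_mul_thueMorse_eq_of_mul (k n) a
    rw [partialComp_succ_apply, hv, map_mul, hu]
    exact ⟨u * partialComp k n v, mul_assoc _ _ _⟩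

theorem exists_partialComp_add_eq (k : ℕ → ℕ) (n m : ℕ) :
    ∃ u, partialComp k (n + m) 𝟎 = partialComp k n (𝟎 * u) := by
  induction m with
  | zero => exact ⟨1, rfl⟩
  | succ m ih =>
    obtain ⟨u, hu⟩ := ih
    obtain ⟨v, hv⟩ := exists_gammaMorph_pow_mul_thueMorse_eq_of_mul (k (n + m)) 0
    have key : ∀ j (v : Word (Fin 2)), ∃ u, partialComp k (n + j) v = partialComp k n u := by
      intro j
      induction j with
      | zero => exact fun v => ⟨v, rfl⟩
      | succ j ih =>
        intro v
        rw [← add_assoc, partialComp_succ_apply]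
        exact ih _
    obtain ⟨v', hv'⟩ := key m v
    refine ⟨u * v', ?_⟩
    rw [← add_assoc, partialComp_succ_apply, hv, map_mul, hu, hv', ← map_mul, mul_assoc]

theorem partialComp_zero_prefix (k : ℕ → ℕ) {n m : ℕ} (h : n ≤ m) :
    (partialComp k n 𝟎).toList <+: (partialComp k m 𝟎).toList := by
  obtain ⟨m, rfl⟩ := Nat.exists_eq_add_of_le h
  obtain ⟨u, hu⟩ := exists_partialComp_add_eq k n m
  rw [hu, map_mul, FreeMonoid.toList_mul]
  exact List.prefix_append _ _

/-- The limit of the words `partialComp k n (0 ^ ω)`. -/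
def limitWord (k : ℕ → ℕ) : InfWord (Fin 2) :=
  -- The default 0 is never read, since level `i + 1` blocks are longer than `i + 1`.
  fun i => (partialComp k (i + 1) 𝟎).toList.getD i 0

theorem getD_partialComp_zero (k : ℕ → ℕ) {n i : ℕ} (h : i < blockLength k n) :
    (partialComp k n 𝟎).toList.getD i 0 = limitWord k i := by
  have h1 : i < (partialComp k n 𝟎).toList.length := by
    rwa [show (partialComp k n 𝟎).toList.length = _ from isUniform_partialComp k n 0]
  have h2 : i < (partialComp k (i + 1) 𝟎).toList.length := by
    rw [show (partialComp k (i + 1) 𝟎).toList.length = _ from isUniform_partialComp k (i + 1) 0]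
    exact (Nat.lt_succ_self i).trans (lt_blockLength k (i + 1))
  unfold limitWord
  rw [List.getD_eq_getElem _ _ h1, List.getD_eq_getElem _ _ h2]
  rcases le_total n (i + 1) with h3 | h3
  · exact (partialComp_zero_prefix k h3).getElem h1
  · exact ((partialComp_zero_prefix k h3).getElem h2).symm

theorem occursAt_limitWord_zero (k : ℕ → ℕ) (n : ℕ) :
    (limitWord k).OccursAt (partialComp k n 𝟎) 0 := by
  intro i hi
  rw [zero_add, ← List.getD_eq_getElem _ 0 hi]
  refine (getD_partialComp_zero k ?_).symm
  rwa [← isUniform_partialComp k n 0]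

theorem exists_occursAt_limitWord (k : ℕ → ℕ) (n q : ℕ) :
    ∃ a, (limitWord k).OccursAt (partialComp k n (FreeMonoid.of a)) (blockLength k n * q) := by
  -- Level `n + m` has a block longer than `m`, so its prefix of `w` covers the `q`-th level-`n`
  -- block.
  let m := blockLength k n * (q + 1)
  obtain ⟨u, hu⟩ := exists_partialComp_add_eq k n m
  have hocc := occursAt_limitWord_zero k (n + m)
  have hlen := isUniform_partialComp k (n + m) 0
  rw [hu] at hocc hlen
  rw [(isUniform_partialComp k n).length_apply] at hlen
  have hq : q < (𝟎 * u).length := by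
    have h1 := lt_blockLength k (n + m)
    rw [← hlen] at h1
    have h2 : blockLength k n * (q + 1) < blockLength k n * (𝟎 * u).length :=
      lt_of_le_of_lt (Nat.le_add_left _ _) h1
    have := lt_of_mul_lt_mul_left h2 (Nat.zero_le _)
    omega
  obtain ⟨a, -, ha⟩ := (isUniform_partialComp k n).occursAt_of_occursAt_apply hocc hq
  exact ⟨a, by simpa using ha⟩

theorem tendsto_image_prefixComp (k : ℕ → ℕ) :
    Tendsto (fun n : ℕ => InfWord.image (prefixComp k n) (fun _ => 0)) atTop
      (𝓝 (limitWord k)) := by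
  rw [tendsto_pi_nhds]
  intro i
  refine tendsto_const_nhds.congr' ?_
  filter_upwards [eventually_ge_atTop i] with n hn
  have hi : i < blockLength k (n + 1) := lt_of_le_of_lt (by omega) (lt_blockLength k (n + 1))
  rw [← getD_partialComp_zero k hi]
  have hpre : InfWord.pre (fun _ => (0 : Fin 2)) (i + 1) =
      𝟎 * FreeMonoid.ofList ((List.range i).map fun _ => (0 : Fin 2)) := by
    apply FreeMonoid.toList.injective
    simp [InfWord.pre, List.replicate_succ]
  have hlt : i < (partialComp k (n + 1) 𝟎).toList.length :=
    hi.trans_eq (isUniform_partialComp k (n + 1) 0).symm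
  unfold InfWord.image
  rw [hpre, map_mul, FreeMonoid.toList_mul, prefixComp_eq_partialComp,
    List.getD_append _ _ _ _ hlt]
  rfl

/-! ### Uniform recurrence. -/

theorem uniformlyRecurrent_limitWord (k : ℕ → ℕ) : (limitWord k).UniformlyRecurrent := by
  rintro u ⟨j, hj⟩
  -- Level-`n` blocks are longer than `n`, so this occurrence of `u` lies inside the prefix
  -- `partialComp k n 𝟎`.
  let n := j + u.length
  have hn := occursAt_limitWord_zero k n
  have hu : ∀ l, (limitWord k).OccursAt (partialComp k n 𝟎) l →
      (limitWord k).OccursAt u (l + j) := by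
    intro l hl i hi
    have h1 : j + i < (partialComp k n 𝟎).toList.length :=
      (lt_of_lt_of_le (by simpa [n, FreeMonoid.length] using hi) (lt_blockLength k n).le).trans_eq
        (isUniform_partialComp k n 0).symm
    rw [← hj i hi, add_assoc, hl _ h1, ← hn _ h1, zero_add]
  let L := blockLength k (n + 1)
  have hL : 0 < L := blockLength_pos _ _
  -- The next aligned level-`(n+1)` block starts at most `L` after `i`; the level-`n` image of 0
  -- starts within its `L` letters, and `u` starts `j` further on.
  refine ⟨2 * L + j, fun i => ?_⟩
  obtain ⟨a, ha⟩ := exists_occursAt_limitWord k (n + 1) (i / L + 1)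
  obtain ⟨x, y, hxy⟩ := zero_mem_gammaMorph_pow_mul_thueMorse (k n) a
  have hlen := isUniform_partialComp k (n + 1) a
  rw [partialComp_succ_apply, hxy, map_mul, map_mul] at ha hlen
  rw [FreeMonoid.length_mul, FreeMonoid.length_mul] at hlen
  have h2 := hu _ ((InfWord.occursAt_mul _ _ _ _).1 ((InfWord.occursAt_mul _ _ _ _).1 ha).1).2
  refine ⟨_, ?_, ?_, h2⟩
  all_goals
    have h3 := Nat.div_add_mod i L
    have h4 := Nat.mod_lt i hL
    change _ = L at hlen
    change _ * (i / L) + _ = _ at h3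
    simp only [← show L = blockLength k (n + 1) from rfl, mul_add, mul_one]
    omega

/-! ### Right special factors and the lower bound. -/

theorem exists_gammaMorph_pow_zero_eq {i k : ℕ} (h : i ≤ k) :
    ∃ y, (gammaMorph ^ k) 𝟎 = (gammaMorph ^ i) 𝟎 * y := by
  induction k, h using Nat.le_induction with
  | base => exact ⟨1, (mul_one _).symm⟩
  | succ k _ ih =>
    obtain ⟨y, hy⟩ := ih
    refine ⟨y * (gammaMorph ^ k) 𝟎 * 𝟏, ?_⟩
    rw [gammaMorph_pow_succ_zero]
    nth_rw 1 [hy]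
    simp only [mul_assoc]

/-- `γ^k(0)` begins with `γ^i(0) γ^i(0) 1`: the first copy is followed by 0, the initial letter of
the second, and the second by 1. -/
theorem exists_gammaMorph_pow_zero_mul_of_factor {i k : ℕ} (h : i < k) (a : Fin 2) :
    ∃ x y, (gammaMorph ^ k) 𝟎 = x * ((gammaMorph ^ i) 𝟎 * FreeMonoid.of a) * y := by
  obtain ⟨y, hy⟩ := exists_gammaMorph_pow_zero_eq (Nat.succ_le_of_lt h)
  rw [Nat.succ_eq_add_one, gammaMorph_pow_succ_zero] at hy
  fin_cases a
  · obtain ⟨v, hv⟩ := exists_gammaMorph_pow_zero_eq_of_mul i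
    refine ⟨1, v * 𝟏 * y, ?_⟩
    rw [hy]
    nth_rw 2 [hv]
    simp only [Fin.zero_eta, mul_assoc, one_mul]
  · exact ⟨(gammaMorph ^ i) 𝟎, y, by simp only [hy, Fin.mk_one, mul_assoc]⟩

/-- The images of the words `γ ^ i (0)`, `i < k n`, are right special factors of the limit. -/
theorem exists_occursAt_partialComp_mul_of (k : ℕ → ℕ) {n i : ℕ} (h : i < k n) (a : Fin 2) :
    ∃ j, (limitWord k).OccursAt
      (partialComp k n ((gammaMorph ^ i) 𝟎) * FreeMonoid.of a) j := by
  obtain ⟨x, y, hxy⟩ := exists_gammaMorph_pow_zero_mul_of_factor h a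
  obtain ⟨v, hv⟩ := exists_partialComp_eq_of_mul k n a
  have hocc := occursAt_limitWord_zero k (n + 1)
  rw [partialComp_succ_apply, gammaMorph_pow_mul_thueMorse_zero, hxy, map_mul, map_mul, map_mul,
    map_mul, hv, InfWord.occursAt_mul, InfWord.occursAt_mul, InfWord.occursAt_mul, ← mul_assoc,
    InfWord.occursAt_mul] at hocc
  exact ⟨_, hocc.1.1.2.1⟩

/-- The suffix of length `m` of the word `u`. -/
def suffixOfLength {A : Type*} (u : Word A) (m : ℕ) : Word A :=
  FreeMonoid.ofList (u.toList.drop (u.length - m))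

theorem exists_mul_suffixOfLength {A : Type*} (u : Word A) (m : ℕ) :
    ∃ x, u = x * suffixOfLength u m :=
  ⟨FreeMonoid.ofList (u.toList.take (u.length - m)), by
    apply FreeMonoid.toList.injective
    simp [suffixOfLength]⟩

theorem length_suffixOfLength {A : Type*} (u : Word A) {m : ℕ} (h : m ≤ u.length) :
    (suffixOfLength u m).length = m := by
  simp only [suffixOfLength, FreeMonoid.length, FreeMonoid.toList_ofList, List.length_drop] at h ⊢
  omega

theorem suffixOfLength_mem_factors (k : ℕ → ℕ) {n i m : ℕ} (h : i < k n)
    (hm : m ≤ blockLength k n * (2 ^ (i + 1) - 1)) (a : Fin 2) :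
    suffixOfLength (partialComp k n ((gammaMorph ^ i) 𝟎)) m * FreeMonoid.of a ∈
      (limitWord k).factors (m + 1) := by
  obtain ⟨j, hj⟩ := exists_occursAt_partialComp_mul_of k h a
  obtain ⟨x, hx⟩ := exists_mul_suffixOfLength (partialComp k n ((gammaMorph ^ i) 𝟎)) m
  have hlen : (partialComp k n ((gammaMorph ^ i) 𝟎)).length =
      blockLength k n * (2 ^ (i + 1) - 1) := by
    rw [(isUniform_partialComp k n).length_apply, ← length_gammaMorph_pow_zero,
      Nat.add_sub_cancel]
  refine ⟨?_, ?_⟩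
  · rw [FreeMonoid.length_mul, FreeMonoid.length_of,
      length_suffixOfLength _ (hm.trans_eq hlen.symm)]
  · rw [hx, mul_assoc, InfWord.occursAt_mul] at hj
    exact ⟨_, hj.2⟩

theorem length_of_pow {A : Type*} (a : A) (i : ℕ) : (FreeMonoid.of a ^ i).length = i := by
  induction i with
  | zero => rfl
  | succ i ih => rw [pow_succ, FreeMonoid.length_mul, ih, FreeMonoid.length_of]

/-- Equal suffixes would end in the images of both `0 1^i` and `1 1^i`, each of length `blockLength
k n * (i + 1) ≤ m`. These images begin with different letters. -/
theorem suffixOfLength_ne (k : ℕ → ℕ) {n i i' m : ℕ} (hii : i < i')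
    (hm : m ≤ blockLength k n * (2 ^ (i + 1) - 1)) (hm' : blockLength k n * (i + 1) ≤ m) :
    suffixOfLength (partialComp k n ((gammaMorph ^ i) 𝟎)) m ≠
      suffixOfLength (partialComp k n ((gammaMorph ^ i') 𝟎)) m := by
  intro heq
  have hL := isUniform_partialComp k n
  have hlen : (partialComp k n ((gammaMorph ^ i) 𝟎)).length =
      blockLength k n * (2 ^ (i + 1) - 1) := by
    rw [hL.length_apply, ← length_gammaMorph_pow_zero, Nat.add_sub_cancel]
  have key : ∀ (u x : Word (Fin 2)) (b : Fin 2), u = x * (FreeMonoid.of b * 𝟏 ^ i) →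
      suffixOfLength (partialComp k n u) m =
        suffixOfLength (partialComp k n ((gammaMorph ^ i) 𝟎)) m →
      (partialComp k n (FreeMonoid.of b * 𝟏 ^ i)).toList <:+
        (suffixOfLength (partialComp k n ((gammaMorph ^ i) 𝟎)) m).toList := by
    intro u x b hu hs
    obtain ⟨y, hy⟩ := exists_mul_suffixOfLength (partialComp k n u) m
    rw [hs] at hy
    refine List.suffix_of_suffix_length_le (l₃ := (partialComp k n u).toList) ?_ ?_ ?_
    · rw [hu, map_mul _ x, FreeMonoid.toList_mul]
      exact List.suffix_append _ _
    · rw [hy, FreeMonoid.toList_mul]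
      exact List.suffix_append _ _
    · change FreeMonoid.length _ ≤ FreeMonoid.length _
      rw [length_suffixOfLength _ (hm.trans_eq hlen.symm), hL.length_apply]
      refine le_trans (le_of_eq ?_) hm'
      rw [FreeMonoid.length_mul, length_of_pow, FreeMonoid.length_of, add_comm]
  obtain ⟨x, hx⟩ := exists_gammaMorph_pow_zero_eq_mul i
  obtain ⟨x', hx'⟩ := exists_gammaMorph_pow_zero_eq_mul i'
  obtain ⟨d, rfl⟩ := Nat.exists_eq_add_of_lt hii
  have h0 := key _ x 0 hx rfl
  have h1 := key _ (x' * 𝟎 * 𝟏 ^ d) 1 (by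
    rw [hx', show i + d + 1 = d + 1 + i by ring, pow_add, pow_succ]
    simp only [mul_assoc]) heq.symm
  have hlen' : ∀ b : Fin 2, (partialComp k n (FreeMonoid.of b * 𝟏 ^ i)).toList.length =
      blockLength k n * (1 + i) := by
    intro b
    change FreeMonoid.length _ = _
    rw [hL.length_apply, FreeMonoid.length_mul, FreeMonoid.length_of, length_of_pow]
  have h2 := List.suffix_of_suffix_length_le h0 h1 ((hlen' 0).trans (hlen' 1).symm).le
  have h3 := h2.eq_of_length ((hlen' 0).trans (hlen' 1).symm)
  obtain ⟨v, hv⟩ := exists_partialComp_eq_of_mul k n 0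
  obtain ⟨v', hv'⟩ := exists_partialComp_eq_of_mul k n 1
  rw [map_mul (partialComp k n) 𝟎, map_mul (partialComp k n) 𝟏, hv, hv'] at h3
  simp at h3

/-- The `j` exponents `j ≤ i < 2j` give distinct special suffixes: `i ≥ j` makes the words long
enough to have suffixes of length `m`, and `i < 2j` makes `m` long enough to tell them apart. -/
theorem mul_le_complexity_limitWord (k : ℕ → ℕ) {n j : ℕ} (hj : 2 * j ≤ k n)
    (hj' : 2 * j ≤ 2 ^ (j + 1) - 1) :
    blockLength k n * (2 ^ (j + 1) - 1 - 2 * j) * j ≤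
      (limitWord k).complexity (blockLength k n * (2 ^ (j + 1) - 1)) := by
  have hsum : blockLength k n * (2 ^ (j + 1) - 1) =
      blockLength k n * (2 * j) + blockLength k n * (2 ^ (j + 1) - 1 - 2 * j) := by
    rw [← mul_add, Nat.add_sub_cancel' hj']
  rw [hsum]
  refine InfWord.mul_card_le_complexity _ _ _ _ fun e he => ?_
  generalize hm : blockLength k n * (2 * j) + e = m
  have hle : ∀ i, j ≤ i → m ≤ blockLength k n * (2 ^ (i + 1) - 1) := fun i hi =>
    calc m ≤ blockLength k n * (2 ^ (j + 1) - 1) := by omega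
      _ ≤ _ := by gcongr; norm_num
  have hge : ∀ i < 2 * j, blockLength k n * (i + 1) ≤ m := fun i hi =>
    calc _ ≤ blockLength k n * (2 * j) := by gcongr; omega
      _ ≤ m := by omega
  classical
  refine ⟨(Finset.Ico j (2 * j)).image fun i =>
    suffixOfLength (partialComp k n ((gammaMorph ^ i) 𝟎)) m, ?_, ?_⟩
  · rw [Finset.card_image_of_injOn, Nat.card_Ico]
    · omega
    · intro i hi i' hi' heq
      simp only [Finset.coe_Ico, Set.mem_Ico] at hi hi'
      by_contra hne
      rcases lt_or_gt_of_ne hne with h | h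
      · exact suffixOfLength_ne k h (hle i hi.1) (hge i hi.2) heq
      · exact suffixOfLength_ne k h (hle i' hi'.1) (hge i' hi'.2) heq.symm
  · intro u hu a
    obtain ⟨i, hi, rfl⟩ := Finset.mem_image.1 hu
    rw [Finset.mem_Ico] at hi
    exact suffixOfLength_mem_factors k (by omega) (hle i hi.1) a

/-! ### Linear complexity and boundedness of `k`. -/

theorem complexity_limitWord_blockLength_le (k : ℕ → ℕ) (n : ℕ) :
    (limitWord k).complexity (blockLength k n) ≤ 4 * (blockLength k n - 1) + 2 :=
  InfWord.complexity_le_of_blocks _ (blockLength_pos k n) (isUniform_partialComp k n)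
    (exists_occursAt_limitWord k n)

theorem atMostLinearComplexity_limitWord_of_bddAbove {k : ℕ → ℕ} (h : BddAbove (Set.range k)) :
    (limitWord k).AtMostLinearComplexity := by
  obtain ⟨K, hK⟩ := h
  refine Asymptotics.IsBigO.of_bound (4 * 2 ^ (K + 1) : ℕ) ?_
  filter_upwards [eventually_gt_atTop 0] with m hm
  -- The least block length exceeding `m` is at most `2^(K+1) * m`, as consecutive block lengths
  -- have ratio at most `2^(K+1)`.
  have hex : ∃ n, m < blockLength k n := ⟨m, lt_blockLength k m⟩
  have hspec := Nat.find_spec hex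
  have hmin := fun n => Nat.find_min (m := n) hex
  generalize Nat.find hex = n at hspec hmin
  rcases n with _ | n
  · simp [blockLength] at hspec
    omega
  · have h1 := not_lt.1 (hmin n (Nat.lt_succ_self n))
    have h2 : blockLength k (n + 1) ≤ m * 2 ^ (K + 1) := by
      rw [blockLength_succ]
      gcongr
      · norm_num
      · exact hK ⟨n, rfl⟩
    have h3 := (limitWord k).complexity_mono hspec.le
    have h4 := complexity_limitWord_blockLength_le k (n + 1)
    have h5 := blockLength_pos k (n + 1)
    rw [Real.norm_natCast, Real.norm_natCast]
    have h6 : (limitWord k).complexity m ≤ 4 * 2 ^ (K + 1) * m := by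
      rw [mul_assoc, mul_comm _ m]
      omega
    exact_mod_cast h6

theorem bddAbove_of_atMostLinearComplexity_limitWord {k : ℕ → ℕ}
    (h : (limitWord k).AtMostLinearComplexity) : BddAbove (Set.range k) := by
  by_contra hk
  obtain ⟨C, hC⟩ := h.bound
  obtain ⟨M, hM⟩ := eventually_atTop.1 hC
  obtain ⟨c, hc⟩ := exists_nat_ge C
  have hbound : ∀ m ≥ M, (limitWord k).complexity m ≤ c * m := by
    intro m hm
    have h1 := hM m hm
    rw [Real.norm_natCast, Real.norm_natCast] at h1
    have h2 := h1.trans (mul_le_mul_of_nonneg_right hc (Nat.cast_nonneg m))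
    exact_mod_cast h2
  -- With `N = 2^(j+1) - 1`, the 4 ensures `4j ≤ N`, so `N ≤ 2(N - 2j)` and the bounds force `j ≤
  -- 2c`, a contradiction; the `M` ensures that the length used is at least `M`.
  obtain ⟨j, hj⟩ : ∃ j, j = 2 * c + M + 4 := ⟨_, rfl⟩
  obtain ⟨_, ⟨n, rfl⟩, hn⟩ := not_bddAbove_iff.1 hk (2 * j)
  have hpow : 4 * j ≤ 2 ^ (j + 1) - 1 := by
    have : ∀ l, 4 * (l + 4) + 1 ≤ 2 ^ (l + 4 + 1) := by
      intro l
      induction l with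
      | zero => norm_num
      | succ l ih =>
        rw [show l + 1 + 4 + 1 = l + 4 + 1 + 1 by ring, pow_succ 2 (l + 4 + 1)]
        omega
    have := this (2 * c + M)
    rw [← hj] at this
    omega
  have h1 := mul_le_complexity_limitWord k hn.le (by omega)
  generalize 2 ^ (j + 1) - 1 = N at *
  have hL := blockLength_pos k n
  generalize blockLength k n = L at *
  have hNL : N ≤ L * N := Nat.le_mul_of_pos_left _ hL
  have h2 := h1.trans (hbound (L * N) (by omega))
  obtain ⟨d, rfl⟩ := Nat.exists_eq_add_of_le (show 2 * j ≤ N by omega)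
  rw [Nat.add_sub_cancel_left, show c * (L * (2 * j + d)) = L * (c * (2 * j + d)) by ring,
    mul_assoc] at h2
  have h3 := Nat.le_of_mul_le_mul_left h2 hL
  have h4 : c * (2 * j + d) ≤ c * (d + d) := Nat.mul_le_mul_left _ (by omega)
  have h5 : d * j ≤ d * (2 * c) := by linarith
  have h6 := Nat.le_of_mul_le_mul_left h5 (by omega)
  omega

theorem proposition3p6 (k : ℕ → ℕ) :
    ∃ w : InfWord (Fin 2),
      Tendsto (fun n : ℕ => InfWord.image (prefixComp k n) (fun _ => 0)) atTop (𝓝 w) ∧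
      w.UniformlyRecurrent ∧
      (w.AtMostLinearComplexity ↔ BddAbove (Set.range k)) ∧
      ∀ n : ℕ,
        (prefixComp k n (FreeMonoid.of 0)).length = (prefixComp k n (FreeMonoid.of 1)).length ∧
        (w.complexity (prefixComp k n (FreeMonoid.of 0)).length : ℤ) ≤
          4 * ((prefixComp k n (FreeMonoid.of 0)).length : ℤ) - 2 := by
  refine ⟨limitWord k, tendsto_image_prefixComp k, uniformlyRecurrent_limitWord k,
    ⟨bddAbove_of_atMostLinearComplexity_limitWord, atMostLinearComplexity_limitWord_of_bddAbove⟩,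
    fun n => ?_⟩
  rw [prefixComp_eq_partialComp, isUniform_partialComp k (n + 1) 0,
    isUniform_partialComp k (n + 1) 1]
  have h1 := complexity_limitWord_blockLength_le k (n + 1)
  have h2 := blockLength_pos k (n + 1)
  exact ⟨rfl, by omega⟩
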